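/- For a topological space $X$ let $\operatorname{nwd}_X$ denote the family of all nowhere dense subsets of $X$, and let $\operatorname{cof}(\operatorname{nwd}_X)$ denote the least cardinality of a subfamily $\mathcal W\subseteq \operatorname{nwd}_X$ such that every $Y\in\operatorname{nwd}_X$ is contained in some $Z\in\mathcal W$. The density of a space is the least cardinality of a dense subset of it. Theorem 5.3. Let $\lambda$ be a cardinal and let $X$ be a non-empty metric space such that every non-empty open subset of $X$ (as a subspace) has density $\lambda$. Then $$\operatorname{cof}(\operatorname{nwd}_X)=\operatorname{cof}(\operatorname{nwd}_{\lambda^\omega}),$$ where $\lambda^\omega$ is the product of countably infinitely many copies of $\lambda$ with the discrete topology, endowed with the product topology. -/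

import Mathlib

open Cardinal

universe u

noncomputable section

/-- The cofinality of a family `F` of subsets of `X`: the least cardinality of a subfamily `W` of
`F` such that every member of `F` is contained in some member of `W`. (Such subfamilies exist, as
`F` itself is one.) -/
def familyCof {X : Type u} (F : Set (Set X)) : Cardinal.{u} :=
  sInf {c | ∃ W : Set (Set X), W ⊆ F ∧ (∀ Y ∈ F, ∃ Z ∈ W, Y ⊆ Z) ∧ #W = c}

/-- The family of all nowhere dense subsets of a topological space `X`. -/
def nwd (X : Type u) [TopologicalSpace X] : Set (Set X) :=
  {A | IsNowhereDense A}

/-- The density of a topological space `X`: the least cardinality of a dense subset. -/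
def spaceDensity (X : Type u) [TopologicalSpace X] : Cardinal.{u} :=
  sInf {c | ∃ D : Set X, Dense D ∧ #D = c}

end

open Set Topology

/-! For infinite `lam`, both spaces carry the same combinatorics: a tree of open cells indexed by
finite sequences in a set `L` of size `lam`, forming a π-base. The cofinality of nwd depends only on
this tree. A nowhere dense set is recorded by the nodes whose cells it meets, which gives one
inequality (`TreeScheme.familyCof_nwd_le`). For the converse a node needs a representative point,
but that point lies in cells of arbitrarily deep nodes. The scheme is arranged so that those nodes
only append the label `zero`, and each label is read as a word, with `zero` read as the empty word.
The deeper nodes then decode to the same sequence (`TreeScheme.le_familyCof_nwd`).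

On `L^ω` the cells are cylinders. On `X` the tree is built by splitting open sets into `lam` small
disjoint open pieces with dense union. This requires the supremum of sizes of cellular families to
be attained inside every open set (`HasLocalDensity.exists_isCellular`). For finite `lam` both
spaces are single points. -/

/-- A Tukey connection between two families of sets compares their cofinalities. -/
theorem familyCof_le_of_tukey {X Y : Type u} {F : Set (Set X)} {G : Set (Set Y)}
    (φ : Set X → Set Y) (ψ : Set Y → Set X) (hφ : ∀ A ∈ F, φ A ∈ G) (hψ : ∀ B ∈ G, ψ B ∈ F)
    (h : ∀ A ∈ F, ∀ B ∈ G, φ A ⊆ B → A ⊆ ψ B) : familyCof F ≤ familyCof G := by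
  have hne : {c | ∃ W : Set (Set Y), W ⊆ G ∧ (∀ Y ∈ G, ∃ Z ∈ W, Y ⊆ Z) ∧ #W = c}.Nonempty :=
    ⟨#G, G, Subset.rfl, fun Y hY => ⟨Y, hY, Subset.rfl⟩, rfl⟩
  obtain ⟨W, hWG, hW, hc⟩ := csInf_mem hne
  have hle : familyCof F ≤ #(ψ '' W) := by
    refine csInf_le' ⟨ψ '' W, ?_, fun A hA => ?_, rfl⟩
    · rintro _ ⟨B, hB, rfl⟩
      exact hψ B (hWG hB)
    · obtain ⟨B, hB, hAB⟩ := hW _ (hφ A hA)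
      exact ⟨ψ B, mem_image_of_mem ψ hB, h A hA B (hWG hB) hAB⟩
  exact hle.trans (mk_image_le.trans hc.le)

theorem IsNowhereDense.exists_isOpen_subset_disjoint {X : Type u} [TopologicalSpace X] {A V : Set X}
    (hA : IsNowhereDense A) (hV : IsOpen V) (hne : V.Nonempty) :
    ∃ V' ⊆ V, IsOpen V' ∧ V'.Nonempty ∧ Disjoint V' A := by
  refine ⟨V \ closure A, sdiff_subset, hV.sdiff isClosed_closure, ?_,
    disjoint_sdiff_left.mono_right subset_closure⟩
  rw [nonempty_iff_ne_empty, ne_eq, sdiff_eq_empty]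
  intro hsub
  have := interior_maximal hsub hV
  rw [hA] at this
  exact hne.ne_empty (subset_empty_iff.1 this)

theorem isNowhereDense_of_forall_exists_disjoint {X : Type u} [TopologicalSpace X] {A : Set X}
    (h : ∀ V : Set X, IsOpen V → V.Nonempty → ∃ V' ⊆ V, IsOpen V' ∧ V'.Nonempty ∧ Disjoint V' A) :
    IsNowhereDense A := by
  by_contra hne
  obtain ⟨V', hsub, ho, ⟨x, hx⟩, hd⟩ := h _ isOpen_interior (nonempty_iff_ne_empty.2 hne)
  exact disjoint_left.1 (hd.closure_right ho) hx (interior_subset (hsub hx))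

/-! ### Tree schemes and the reduction to the tree -/

/-- The nowhere dense subsets of the tree of finite sequences in `L`. Sequences are lists written
backwards, so that `t` extends `s` when `s` is a suffix of `t`. -/
def treeNwd (L : Type u) : Set (Set (List L)) :=
  {A | ∀ s, ∃ t, s <:+ t ∧ ∀ t', t <:+ t' → t' ∉ A}

/-- A `π`-base of `X` indexed by the tree of finite sequences in `L`, with a point chosen in each
of its members, such that the point of a node is also the point of its child with label `zero`. -/
structure TreeScheme (L : Type u) (X : Type u) [TopologicalSpace X] where
  zero : L
  cell : List L → Set X
  point : List L → X
  isOpen_cell : ∀ s, IsOpen (cell s)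
  point_mem : ∀ s, point s ∈ cell s
  cell_cons_subset : ∀ a s, cell (a :: s) ⊆ cell s
  disjoint_cell : ∀ a b s, a ≠ b → Disjoint (cell (a :: s)) (cell (b :: s))
  point_zero_cons : ∀ s, point (zero :: s) = point s
  mem_root : ∀ x, x ∈ cell []
  exists_cell_subset : ∀ s V, IsOpen V → V.Nonempty → V ⊆ cell s → ∃ t, s <:+ t ∧ cell t ⊆ V

namespace TreeScheme

variable {L X : Type u} [TopologicalSpace X] (S : TreeScheme L X)

theorem cell_anti {s t : List L} (h : s <:+ t) : S.cell t ⊆ S.cell s := by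
  obtain ⟨r, rfl⟩ := h
  induction r with
  | nil => exact Subset.rfl
  | cons a r ih => exact (S.cell_cons_subset a _).trans ih

theorem exists_cell_subset_of_nonempty {V : Set X} (hV : IsOpen V) (hne : V.Nonempty) :
    ∃ t, S.cell t ⊆ V := by
  obtain ⟨t, -, ht⟩ := S.exists_cell_subset [] V hV hne fun x _ => S.mem_root x
  exact ⟨t, ht⟩

theorem cell_nonempty (s : List L) : (S.cell s).Nonempty := ⟨_, S.point_mem s⟩

theorem eq_of_mem_cell {x : X} : ∀ {s t : List L}, s.length = t.length →
    x ∈ S.cell s → x ∈ S.cell t → s = t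
  | [], [], _, _, _ => rfl
  | a :: s, b :: t, h, hs, ht => by
    obtain rfl : s = t := eq_of_mem_cell (by simpa using h)
      (S.cell_cons_subset a s hs) (S.cell_cons_subset b t ht)
    by_contra hab
    exact disjoint_left.1 (S.disjoint_cell a b s fun h => hab (h ▸ rfl)) hs ht

theorem suffix_of_mem_cell {x : X} {s t : List L} (hs : x ∈ S.cell s) (ht : x ∈ S.cell t)
    (h : s.length ≤ t.length) : s <:+ t := by
  have hsuf : t.drop (t.length - s.length) <:+ t := List.drop_suffix _ _
  rwa [← S.eq_of_mem_cell (by rw [List.length_drop]; omega) hs (S.cell_anti hsuf ht)] at hsuf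

theorem point_replicate (n : ℕ) (s : List L) :
    S.point (List.replicate n S.zero ++ s) = S.point s := by
  induction n with
  | zero => rfl
  | succ n ih => rw [List.replicate_succ, List.cons_append, point_zero_cons, ih]

/-- A cell containing the point of `s` belongs to a node on the branch through `s` that is constantly
`zero` after `s`. -/
theorem suffix_or_eq_replicate {s t : List L} (h : S.point s ∈ S.cell t) :
    t <:+ s ∨ ∃ n, t = List.replicate n S.zero ++ s := by
  rcases le_total t.length s.length with hl | hl
  · exact .inl (S.suffix_of_mem_cell h (S.point_mem s) hl)
  · refine .inr ⟨t.length - s.length, S.eq_of_mem_cell (by simp; omega) h ?_⟩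
    rw [← S.point_replicate]
    exact S.point_mem _

/-- Concatenation of the words coded by the entries of a finite sequence. -/
def decode (e : L → List L) : List L → List L
  | [] => []
  | a :: s => e a ++ decode e s

theorem decode_append (e : L → List L) (r s : List L) :
    decode e (r ++ s) = decode e r ++ decode e s := by
  induction r with
  | nil => rfl
  | cons a r ih => simp [decode, ih]

theorem decode_suffix (e : L → List L) {s t : List L} (h : s <:+ t) :
    decode e s <:+ decode e t := by
  obtain ⟨r, rfl⟩ := h
  exact ⟨_, (decode_append e r s).symm⟩

theorem decode_replicate (e : L → List L) {a : L} (ha : e a = []) (n : ℕ) :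
    decode e (List.replicate n a) = [] := by
  induction n with
  | zero => rfl
  | succ n ih => rw [List.replicate_succ, decode, ha, ih, List.nil_append]

theorem familyCof_nwd_le (S : TreeScheme L X) : familyCof (nwd X) ≤ familyCof (treeNwd L) := by
  refine familyCof_le_of_tukey (fun A => {s | (S.cell s ∩ A).Nonempty})
    (fun B => {x | ∀ t, x ∈ S.cell t → ∃ t', t <:+ t' ∧ t' ∈ B}) ?_ ?_ ?_
  · intro A hA s
    obtain ⟨V, hVs, hV, hne, hd⟩ :=
      hA.exists_isOpen_subset_disjoint (S.isOpen_cell s) (S.cell_nonempty s)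
    obtain ⟨t, hst, ht⟩ := S.exists_cell_subset s V hV hne hVs
    refine ⟨t, hst, fun t' htt' => ?_⟩
    rw [mem_ofPred_eq, ← not_disjoint_iff_nonempty_inter, not_not]
    exact hd.mono_left ((S.cell_anti htt').trans ht)
  · intro B hB
    refine isNowhereDense_of_forall_exists_disjoint fun V hV hne => ?_
    obtain ⟨s, hs⟩ := S.exists_cell_subset_of_nonempty hV hne
    obtain ⟨t, hst, ht⟩ := hB s
    refine ⟨S.cell t, (S.cell_anti hst).trans hs, S.isOpen_cell t, S.cell_nonempty t,
      disjoint_left.2 fun x hx hx' => ?_⟩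
    obtain ⟨t', htt', ht'⟩ := hx' t hx
    exact ht t' htt' ht'
  · intro A _ B _ h x hx t hxt
    exact ⟨t, List.suffix_rfl, h ⟨x, hxt, hx⟩⟩

/-- Surjectivity of `e` lets one child realise any prescribed extension of the decoded word, while
`h0` makes the zero labels invisible to decoding. -/
theorem le_familyCof_nwd (S : TreeScheme L X) (e : L → List L) (he : Function.Surjective e) (h0 : e S.zero = []) :
    familyCof (treeNwd L) ≤ familyCof (nwd X) := by
  refine familyCof_le_of_tukey
    (fun A => {x | ∀ s, x ∈ S.cell s → ∃ t, decode e s <:+ t ∧ t ∈ A})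
    (fun B => {t | ∀ s, decode e s <:+ t → (S.cell s ∩ B).Nonempty}) ?_ ?_ ?_
  · intro A hA
    refine isNowhereDense_of_forall_exists_disjoint fun V hV hne => ?_
    obtain ⟨s, hs⟩ := S.exists_cell_subset_of_nonempty hV hne
    obtain ⟨t, ⟨r, rfl⟩, ht⟩ := hA (decode e s)
    obtain ⟨a, rfl⟩ := he r
    refine ⟨S.cell (a :: s), (S.cell_cons_subset a s).trans hs, S.isOpen_cell _, S.cell_nonempty _,
      disjoint_left.2 fun x hx hx' => ?_⟩
    obtain ⟨t', htt', ht'⟩ := hx' _ hx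
    exact ht t' htt' ht'
  · intro B hB t
    obtain ⟨a, ha⟩ := he t
    obtain ⟨V, hVs, hV, hne, hd⟩ :=
      IsNowhereDense.exists_isOpen_subset_disjoint hB (S.isOpen_cell [a]) (S.cell_nonempty [a])
    obtain ⟨s, has, hs⟩ := S.exists_cell_subset [a] V hV hne hVs
    refine ⟨decode e s, ?_, fun t' ht' h => ?_⟩
    · simpa [decode, ha] using decode_suffix e has
    · exact not_disjoint_iff_nonempty_inter.2 (h s ht') (hd.mono_left hs)
  · intro A _ B _ h t ht s hst
    refine ⟨S.point s, S.point_mem s, h fun s' hs' => ⟨t, ?_, ht⟩⟩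
    -- A cell around the chosen point is either above `s`, hence decodes to a suffix, or adds only
    -- zeros, hence decodes to the same word.
    rcases S.suffix_or_eq_replicate hs' with hsuf | ⟨n, rfl⟩
    · exact (decode_suffix e hsuf).trans hst
    · rwa [decode_append, decode_replicate e h0, List.nil_append]

theorem familyCof_nwd_eq (S : TreeScheme L X) [Infinite L] : familyCof (nwd X) = familyCof (treeNwd L) := by
  obtain ⟨e⟩ := Cardinal.eq.1 (mk_list_eq_mk L).symm
  classical
  exact le_antisymm S.familyCof_nwd_le
    (S.le_familyCof_nwd (e.setValue S.zero []) (Equiv.surjective _) (Equiv.setValue_eq _ _ _))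

end TreeScheme

/-! ### The tree scheme of cylinders on the sequence space -/

open PiNat in
theorem res_suffix_res {L : Type u} (x : ℕ → L) {m n : ℕ} (h : m ≤ n) : res x m <:+ res x n := by
  induction n, h using Nat.le_induction with
  | base => exact List.suffix_rfl
  | succ n _ ih => exact ih.trans (List.suffix_cons _ _)

open PiNat in
theorem exists_res_eq {L : Type u} (a : L) (s : List L) :
    ∃ x : ℕ → L, res x s.length = s ∧ ∀ n, s.length ≤ n → x n = a := by
  induction s with
  | nil => exact ⟨fun _ => a, rfl, fun _ _ => rfl⟩
  | cons b s ih =>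
    obtain ⟨x, hx, hx'⟩ := ih
    refine ⟨Function.update x s.length b, ?_, fun n hn => ?_⟩
    · rw [List.length_cons, res_succ, Function.update_self]
      congr 1
      conv_rhs => rw [← hx]
      exact res_eq_res.2 fun m hm => Function.update_of_ne hm.ne _ _
    · rw [List.length_cons] at hn
      rw [Function.update_of_ne (by omega), hx' n (by omega)]

-- The point of a node continues it by the constant `a₀`, so appending the label `a₀` does not
-- change it.
open PiNat in
theorem exists_treeScheme_pi (L : Type u) [TopologicalSpace L] [DiscreteTopology L] (a₀ : L) :
    Nonempty (TreeScheme L (ℕ → L)) := by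
  choose p hp hp' using exists_res_eq a₀
  refine ⟨{
    zero := a₀
    cell := fun s => {x | res x s.length = s}
    point := p
    isOpen_cell := fun s => ?_
    point_mem := hp
    cell_cons_subset := fun a s x hx => (List.cons.inj hx).2
    disjoint_cell := fun a b s hab => disjoint_left.2 fun x hx hx' =>
      hab ((List.cons.inj hx).1.symm.trans (List.cons.inj hx').1)
    point_zero_cons := fun s => ?_
    mem_root := fun x => rfl
    exists_cell_subset := fun s V hV hne hVs => ?_ }⟩
  · have := isOpen_cylinder (fun _ => L) (p s) s.length
    rwa [cylinder_eq_res, hp] at this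
  · funext n
    rcases lt_or_ge n s.length with h | h
    · have := (List.cons.inj (hp (a₀ :: s))).2
      rw [← hp s, hp s] at this
      exact res_eq_res.1 (this.trans (hp s).symm) h
    · rw [hp' s n h]
      rcases h.eq_or_lt with rfl | h
      · exact (List.cons.inj (hp (a₀ :: s))).1
      · exact hp' _ n h
  · obtain ⟨x, hx⟩ := hne
    obtain ⟨_, ⟨y, n, rfl⟩, hxy, hsub⟩ :=
      (isTopologicalBasis_cylinders fun _ : ℕ => L).exists_subset_of_mem_open hx hV
    refine ⟨res x (max n s.length), ?_, fun z hz => hsub ?_⟩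
    · have hs : res x s.length = s := hVs hx
      conv_lhs => rw [← hs]
      exact res_suffix_res x (le_max_right _ _)
    · rw [mem_ofPred_eq, res_length] at hz
      rw [mem_cylinder_iff] at hxy ⊢
      exact fun i hi => (res_eq_res.1 hz (lt_max_of_lt_left hi)).trans (hxy i hi)

/-! ### Disjoint families of open sets -/

theorem exists_maximal_pairwiseDisjoint {X : Type u} (P : Set X → Prop)
    (hP : ∀ V, P V → V.Nonempty) (𝓖₀ : Set (Set X)) (h₀ : ∀ G ∈ 𝓖₀, P G)
    (hd₀ : 𝓖₀.PairwiseDisjoint id) :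
    ∃ 𝓖, 𝓖₀ ⊆ 𝓖 ∧ (∀ G ∈ 𝓖, P G) ∧ 𝓖.PairwiseDisjoint id ∧
      ∀ V, P V → ∃ G ∈ 𝓖, (V ∩ G).Nonempty := by
  obtain ⟨𝓖, h0, hmax⟩ := zorn_subset_nonempty
    {𝓖 : Set (Set X) | (∀ G ∈ 𝓖, P G) ∧ 𝓖.PairwiseDisjoint id} (fun c hc hchain _ =>
      ⟨⋃₀ c, ⟨fun G ⟨𝓗, h𝓗, hG⟩ => (hc h𝓗).1 G hG,
        (pairwiseDisjoint_sUnion hchain.directedOn).2 fun 𝓗 h𝓗 => (hc h𝓗).2⟩,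
        fun 𝓗 h𝓗 => subset_sUnion_of_mem h𝓗⟩) 𝓖₀ ⟨h₀, hd₀⟩
  refine ⟨𝓖, h0, hmax.prop.1, hmax.prop.2, fun V hV => ?_⟩
  by_contra! hcon
  have hdisj : ∀ G ∈ 𝓖, Disjoint V G := fun G hG => disjoint_iff_inter_eq_empty.2 (hcon G hG)
  have hmem : V ∈ 𝓖 := hmax.le_of_ge (y := insert V 𝓖)
    ⟨fun G hG => hG.elim (fun h => h ▸ hV) (hmax.prop.1 G),
      hmax.prop.2.insert fun G hG _ => hdisj G hG⟩ (subset_insert _ _) (mem_insert _ _)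
  exact (hP V hV).ne_empty (disjoint_self.1 (hdisj V hmem))

/-- A disjoint family of non-empty open subsets of `U`. -/
structure IsCellular {X : Type u} [TopologicalSpace X] (U : Set X) (𝓖 : Set (Set X)) : Prop where
  isOpen : ∀ G ∈ 𝓖, IsOpen G
  nonempty : ∀ G ∈ 𝓖, G.Nonempty
  subset : ∀ G ∈ 𝓖, G ⊆ U
  disjoint : 𝓖.PairwiseDisjoint id

/-- Each member contains a point of `D`, and disjointness makes the choice injective. -/
theorem IsCellular.mk_le {X : Type u} [TopologicalSpace X] {U D : Set X} {𝓖 : Set (Set X)}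
    (h : IsCellular U 𝓖) (hD : U ⊆ closure D) : #𝓖 ≤ #D := by
  have key : ∀ G : 𝓖, ∃ x : D, (x : X) ∈ (G : Set X) := fun G => by
    obtain ⟨x, hx⟩ := h.nonempty _ G.2
    obtain ⟨y, hyG, hyD⟩ := mem_closure_iff.1 (hD (h.subset _ G.2 hx)) _ (h.isOpen _ G.2) hx
    exact ⟨⟨y, hyD⟩, hyG⟩
  choose f hf using key
  refine mk_le_of_injective (f := f) fun G H hGH => Subtype.ext ?_
  exact h.disjoint.elim_set G.2 H.2 (f G) (hf G) (hGH ▸ hf H)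

theorem exists_isCellular_iUnion {X : Type u} [TopologicalSpace X] {U : Set X} {V : ℕ → Set X}
    (hVU : ∀ n, V n ⊆ U) (hV : Pairwise (Function.onFun Disjoint V)) (F : ℕ → Set (Set X))
    (hF : ∀ n, IsCellular (V n) (F n)) :
    IsCellular U (⋃ n, F n) ∧ #(⋃ n, F n) = Cardinal.sum fun n => #(F n) := by
  have hne : ∀ {m n G H}, G ∈ F m → H ∈ F n → m ≠ n → Disjoint G H := fun hG hH hmn =>
    (hV hmn).mono ((hF _).subset _ hG) ((hF _).subset _ hH)
  refine ⟨⟨?_, ?_, ?_, ?_⟩, ?_⟩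
  · exact fun G hG => let ⟨n, hn⟩ := mem_iUnion.1 hG; (hF n).isOpen G hn
  · exact fun G hG => let ⟨n, hn⟩ := mem_iUnion.1 hG; (hF n).nonempty G hn
  · exact fun G hG => let ⟨n, hn⟩ := mem_iUnion.1 hG; ((hF n).subset G hn).trans (hVU n)
  · intro G hG H hH hGH
    obtain ⟨m, hm⟩ := mem_iUnion.1 hG
    obtain ⟨n, hn⟩ := mem_iUnion.1 hH
    rcases eq_or_ne m n with rfl | hmn
    · exact (hF m).disjoint hm hn hGH
    · exact hne hm hn hmn
  · have := mk_iUnion_eq_sum_mk_lift (f := F) fun m n hmn => disjoint_left.2 fun G hm hn =>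
      ((hF m).nonempty G hm).ne_empty (disjoint_self.1 (hne hm hn hmn))
    simpa using this

theorem exists_disjoint_isOpen_seq {X : Type u} [TopologicalSpace X] [T2Space X] {U : Set X}
    (hU : IsOpen U) (hinf : U.Infinite) :
    ∃ V : ℕ → Set X, (∀ n, IsOpen (V n)) ∧ (∀ n, (V n).Nonempty) ∧ (∀ n, V n ⊆ U) ∧
      Pairwise (Function.onFun Disjoint V) := by
  have := hinf.to_subtype
  obtain ⟨V, hVi, hVo, hVd⟩ := exists_seq_infinite_isOpen_pairwise_disjoint U
  refine ⟨fun n => (↑) '' V n, fun n => hU.isOpenMap_subtype_val _ (hVo n),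
    fun n => (hVi n).nonempty.image _, fun n => Subtype.coe_image_subset _ _, fun m n hmn => ?_⟩
  exact (disjoint_image_iff Subtype.val_injective).2 (hVd hmn)

section Metric

variable {X : Type u} [MetricSpace X]

/-- A maximal small family extending `𝓖₀` works: a small neighbourhood missing all of its members
could be added. -/
theorem exists_isCellular_dense {U : Set X} (hU : IsOpen U) {ε : ℝ} (hε : 0 < ε)
    {𝓖₀ : Set (Set X)} (h₀ : IsCellular U 𝓖₀) (hs : ∀ G ∈ 𝓖₀, ∀ x ∈ G, ∀ y ∈ G, dist x y < ε) :
    ∃ 𝓖, 𝓖₀ ⊆ 𝓖 ∧ IsCellular U 𝓖 ∧ (∀ G ∈ 𝓖, ∀ x ∈ G, ∀ y ∈ G, dist x y < ε) ∧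
      U ⊆ closure (⋃₀ 𝓖) := by
  obtain ⟨𝓖, hsub, hP, hd, hmax⟩ := exists_maximal_pairwiseDisjoint
    (fun G => IsOpen G ∧ G.Nonempty ∧ G ⊆ U ∧ ∀ x ∈ G, ∀ y ∈ G, dist x y < ε)
    (fun _ h => h.2.1) 𝓖₀
    (fun G hG => ⟨h₀.isOpen G hG, h₀.nonempty G hG, h₀.subset G hG, hs G hG⟩) h₀.disjoint
  refine ⟨𝓖, hsub, ⟨fun G hG => (hP G hG).1, fun G hG => (hP G hG).2.1,
    fun G hG => (hP G hG).2.2.1, hd⟩, fun G hG => (hP G hG).2.2.2, fun x hx => ?_⟩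
  refine mem_closure_iff.2 fun O hO hxO => ?_
  obtain ⟨G, hG, y, hy, hyG⟩ := hmax (O ∩ U ∩ Metric.ball x (ε / 2))
    ⟨(hO.inter hU).inter Metric.isOpen_ball, ⟨x, ⟨hxO, hx⟩, Metric.mem_ball_self (half_pos hε)⟩,
      fun y hy => hy.1.2, fun y hy z hz => by
        have h1 := Metric.mem_ball.1 hy.2
        have h2 := Metric.mem_ball'.1 hz.2
        linarith [dist_triangle y x z]⟩
  exact ⟨y, hy.1.1, G, hG, hyG⟩

theorem isCellular_empty (U : Set X) : IsCellular U ∅ :=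
  ⟨by simp, by simp, by simp, by simp⟩

theorem IsCellular.exists_small {U : Set X} {𝓖 : Set (Set X)} (h : IsCellular U 𝓖) {ε : ℝ}
    (hε : 0 < ε) : ∃ 𝓗, IsCellular U 𝓗 ∧ (∀ G ∈ 𝓗, ∀ x ∈ G, ∀ y ∈ G, dist x y < ε) ∧ #𝓗 = #𝓖 := by
  choose p hp using fun G : 𝓖 => h.nonempty G G.2
  let f : 𝓖 → Set X := fun G => (G : Set X) ∩ Metric.ball (p G) (ε / 2)
  have hpf : ∀ G, p G ∈ f G := fun G => ⟨hp G, Metric.mem_ball_self (half_pos hε)⟩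
  refine ⟨range f, ⟨?_, ?_, ?_, ?_⟩, ?_, mk_range_eq f fun G H hGH => Subtype.ext ?_⟩
  · rintro _ ⟨G, rfl⟩
    exact (h.isOpen G G.2).inter Metric.isOpen_ball
  · rintro _ ⟨G, rfl⟩
    exact ⟨p G, hpf G⟩
  · rintro _ ⟨G, rfl⟩
    exact inter_subset_left.trans (h.subset G G.2)
  · rintro _ ⟨G, rfl⟩ _ ⟨H, rfl⟩ hGH
    exact (h.disjoint G.2 H.2 fun he => hGH (by rw [Subtype.ext he])).mono inter_subset_left
      inter_subset_left
  · rintro _ ⟨G, rfl⟩ x hx y hy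
    have h1 := Metric.mem_ball.1 hx.2
    have h2 := Metric.mem_ball'.1 hy.2
    linarith [dist_triangle x (p G) y]
  · exact h.disjoint.elim_set G.2 H.2 (p G) (hp G) (hGH ▸ hpf G : p G ∈ f H).1

/-! ### Cellularity of open sets of constant local density -/

/-- Every non-empty open subset has density `lam`. -/
structure HasLocalDensity (X : Type u) [TopologicalSpace X] (lam : Cardinal.{u}) : Prop where
  exists_dense : ∀ U : Set X, IsOpen U → U.Nonempty → ∃ D ⊆ U, U ⊆ closure D ∧ #D = lam
  le_mk : ∀ U : Set X, IsOpen U → U.Nonempty → ∀ D ⊆ U, U ⊆ closure D → lam ≤ #D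

theorem hasLocalDensity_of_spaceDensity {Y : Type u} [TopologicalSpace Y] {lam : Cardinal.{u}}
    (hX : ∀ U : Set Y, IsOpen U → U.Nonempty → spaceDensity U = lam) : HasLocalDensity Y lam := by
  refine ⟨fun U hU hne => ?_, fun U hU hne D hDU hD => ?_⟩
  · have hex : {c | ∃ D : Set U, Dense D ∧ #D = c}.Nonempty := ⟨_, univ, dense_univ, rfl⟩
    obtain ⟨D, hD, hc⟩ := csInf_mem hex
    refine ⟨(↑) '' D, Subtype.coe_image_subset _ _, Subtype.dense_iff.1 hD, ?_⟩
    rw [mk_image_eq Subtype.val_injective, hc]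
    exact hX U hU hne
  · rw [← hX U hU hne]
    have himg : ((↑) : U → Y) '' ((↑) ⁻¹' D) = D := by
      rw [Subtype.image_preimage_coe, inter_eq_right.2 hDU]
    rw [← himg, mk_image_eq Subtype.val_injective]
    exact csInf_le' ⟨_, Subtype.dense_iff.2 (by rwa [himg]), rfl⟩

namespace HasLocalDensity

variable {lam : Cardinal.{u}} (hX : HasLocalDensity X lam) {U : Set X} (hU : IsOpen U)
  (hne : U.Nonempty)
include hX hU hne

theorem mk_cellular_le {𝓖 : Set (Set X)} (h : IsCellular U 𝓖) : #𝓖 ≤ lam := by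
  obtain ⟨D, -, hD, rfl⟩ := hX.exists_dense U hU hne
  exact h.mk_le hD

theorem infinite (hlam : ℵ₀ ≤ lam) : U.Infinite :=
  infinite_coe_iff.1 (infinite_iff.2 (hlam.trans (hX.le_mk U hU hne U Subset.rfl subset_closure)))

/-- Points chosen from the members of dense families of mesh `1/(n+1)`, over all `n`, together form
a dense subset of `U`. -/
theorem exists_le_sum : ∃ 𝓖 : ℕ → Set (Set X), (∀ n, IsCellular U (𝓖 n)) ∧
    lam ≤ Cardinal.sum fun n => #(𝓖 n) := by
  choose 𝓖 _ h𝓖 hsmall hdense using fun n : ℕ => exists_isCellular_dense hU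
    (Nat.one_div_pos_of_nat (α := ℝ) (n := n)) (isCellular_empty U) (by simp)
  refine ⟨𝓖, h𝓖, ?_⟩
  choose p hp using fun (n : ℕ) (G : 𝓖 n) => (h𝓖 n).nonempty G G.2
  rw [← mk_sigma]
  refine (hX.le_mk U hU hne (range fun q : Σ n, 𝓖 n => p q.1 q.2) ?_ ?_).trans mk_range_le
  · rintro _ ⟨q, rfl⟩
    exact (h𝓖 q.1).subset _ q.2.2 (hp _ _)
  · intro x hx
    refine Metric.mem_closure_iff.2 fun ε hε => ?_
    obtain ⟨n, hn⟩ := exists_nat_one_div_lt (half_pos hε)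
    obtain ⟨y, ⟨G, hG, hyG⟩, hxy⟩ := Metric.mem_closure_iff.1 (hdense n hx) _ (half_pos hε)
    refine ⟨_, ⟨⟨n, G, hG⟩, rfl⟩, ?_⟩
    have := hsmall n G hG y hyG _ (hp n ⟨G, hG⟩)
    linarith [dist_triangle x y (p n ⟨G, hG⟩)]

theorem exists_isCellular_of_lt (hlam : ℵ₀ ≤ lam) {κ : Cardinal.{u}} (hκ : κ < lam) :
    ∃ 𝓖, IsCellular U 𝓖 ∧ κ ≤ #𝓖 := by
  rcases le_total κ ℵ₀ with hle | hle
  · obtain ⟨V, hVo, hVn, hVU, hVd⟩ := exists_disjoint_isOpen_seq hU (hX.infinite hU hne hlam)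
    obtain ⟨h, hc⟩ := exists_isCellular_iUnion hVU hVd (fun n => {V n}) fun n =>
      ⟨by simpa using hVo n, by simpa using hVn n, by simp, by simp⟩
    exact ⟨_, h, hle.trans (by rw [hc]; simp)⟩
  -- If every cellular family had size below `κ`, the sum would be at most `ℵ₀ * κ = κ < lam`.
  · obtain ⟨𝓖, h𝓖, hsum⟩ := hX.exists_le_sum hU hne
    by_contra! hcon
    refine absurd (hsum.trans (Cardinal.sum_le_sum _ (fun _ => κ) fun n => (hcon _ (h𝓖 n)).le))
      (not_le.2 ?_)
    simpa [aleph0_mul_eq hle] using hκ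

/-- If no single family reaches `lam`, the sizes are spread over infinitely many disjoint open
subsets of `U`: the `n`-th one hosts at least `#(𝓖 n)` cells, and the union reaches the sum. -/
theorem exists_isCellular (hlam : ℵ₀ ≤ lam) : ∃ 𝓖, IsCellular U 𝓖 ∧ lam ≤ #𝓖 := by
  obtain ⟨𝓖, h𝓖, hsum⟩ := hX.exists_le_sum hU hne
  by_cases hex : ∃ n, lam ≤ #(𝓖 n)
  · exact hex.elim fun n hn => ⟨_, h𝓖 n, hn⟩
  · push Not at hex
    obtain ⟨V, hVo, hVn, hVU, hVd⟩ := exists_disjoint_isOpen_seq hU (hX.infinite hU hne hlam)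
    choose F hF hle using fun n => hX.exists_isCellular_of_lt (hVo n) (hVn n) hlam (hex n)
    obtain ⟨h, hc⟩ := exists_isCellular_iUnion hVU hVd F hF
    exact ⟨_, h, hc ▸ hsum.trans (Cardinal.sum_le_sum _ _ hle)⟩

/-- A non-empty open set splits, up to a nowhere dense remainder, into `lam` small cells, one of
which contains a given point. -/
theorem exists_partition (hlam : ℵ₀ ≤ lam) {L : Type u} (hL : #L = lam) (a₀ : L) {x : X}
    (hx : x ∈ U) {ε : ℝ} (hε : 0 < ε) :
    ∃ G : L → Set X, (∀ a, IsOpen (G a)) ∧ (∀ a, (G a).Nonempty) ∧ (∀ a, G a ⊆ U) ∧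
      Pairwise (Function.onFun Disjoint G) ∧ x ∈ G a₀ ∧
      (∀ a, ∀ y ∈ G a, ∀ z ∈ G a, dist y z < ε) ∧ U ⊆ closure (⋃ a, G a) := by
  obtain ⟨y, hy, hyx⟩ := (hX.infinite hU hne hlam).nontrivial.exists_ne x
  obtain ⟨δ, hδ, hball⟩ := Metric.isOpen_iff.1 hU x hx
  have hxy : 0 < dist y x := dist_pos.2 hyx
  -- The bound `ε / 2` makes the ball small, `δ` keeps it inside `U`, and `dist y x` leaves `y`
  -- outside the closed ball, so that room remains for `lam` further cells.
  obtain ⟨r, hr, hrm⟩ := exists_between (lt_min (half_pos hε) (lt_min hxy hδ))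
  rw [lt_min_iff, lt_min_iff] at hrm
  obtain ⟨hrε, hry, hrδ⟩ := hrm
  obtain ⟨𝓗₀, h𝓗₀, hle₀⟩ := hX.exists_isCellular (hU.sdiff (Metric.isClosed_closedBall (x := x)
    (ε := r))) ⟨y, hy, fun h => hry.not_ge (Metric.mem_closedBall.1 h)⟩ hlam
  obtain ⟨𝓗, h𝓗, hsmall, hcard⟩ := h𝓗₀.exists_small hε
  have hdisj : ∀ G ∈ 𝓗, Disjoint (Metric.ball x r) G := fun G hG => disjoint_left.2
    fun z hz hzG => (h𝓗.subset G hG hzG).2 (Metric.ball_subset_closedBall hz)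
  have hcell : IsCellular U (insert (Metric.ball x r) 𝓗) :=
    ⟨forall_mem_insert.2 ⟨Metric.isOpen_ball, h𝓗.isOpen⟩,
      forall_mem_insert.2 ⟨⟨x, Metric.mem_ball_self hr⟩, h𝓗.nonempty⟩,
      forall_mem_insert.2 ⟨(Metric.ball_subset_ball hrδ.le).trans hball,
        fun G hG => (h𝓗.subset G hG).trans sdiff_subset⟩,
      h𝓗.disjoint.insert fun G hG _ => hdisj G hG⟩
  have hcs : ∀ G ∈ insert (Metric.ball x r) 𝓗, ∀ y ∈ G, ∀ z ∈ G, dist y z < ε := by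
    refine forall_mem_insert.2 ⟨fun y hy z hz => ?_, hsmall⟩
    have h1 := Metric.mem_ball.1 hy
    have h2 := Metric.mem_ball'.1 hz
    linarith [dist_triangle y x z]
  obtain ⟨𝓖, hsub, h𝓖, h𝓖s, hdense⟩ := exists_isCellular_dense hU hε hcell hcs
  have hc : #L = #𝓖 := by
    refine hL.trans (le_antisymm ?_ (hX.mk_cellular_le hU hne h𝓖))
    exact hle₀.trans (hcard.ge.trans (mk_le_mk_of_subset ((subset_insert _ _).trans hsub)))
  obtain ⟨e₀⟩ := Cardinal.eq.1 hc
  classical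
  let B : 𝓖 := ⟨Metric.ball x r, hsub (mem_insert _ _)⟩
  let e := e₀.setValue a₀ B
  have he : e a₀ = B := Equiv.setValue_eq _ _ _
  refine ⟨fun a => e a, fun a => h𝓖.isOpen _ (e a).2, fun a => h𝓖.nonempty _ (e a).2,
    fun a => h𝓖.subset _ (e a).2, fun a b hab => h𝓖.disjoint (e a).2 (e b).2 fun h =>
      hab (e.injective (Subtype.ext h)), ?_, fun a => h𝓖s _ (e a).2, ?_⟩
  · change x ∈ (e a₀ : Set X)
    rw [he]
    exact Metric.mem_ball_self hr
  · refine hdense.trans (closure_mono (sUnion_subset fun G hG => ?_))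
    obtain ⟨a, ha⟩ := e.surjective ⟨G, hG⟩
    exact subset_iUnion_of_subset a (by rw [ha])

end HasLocalDensity

/-! ### The tree scheme on the metric space -/

/-- A non-empty open set with a chosen point. -/
abbrev PointedOpen (X : Type u) [TopologicalSpace X] : Type u :=
  {Q : Set X × X // IsOpen Q.1 ∧ Q.2 ∈ Q.1}

theorem HasLocalDensity.exists_children {lam : Cardinal.{u}} (hX : HasLocalDensity X lam)
    (hlam : ℵ₀ ≤ lam) {L : Type u} (hL : #L = lam) (a₀ : L) (Q : PointedOpen X) (n : ℕ) :
    ∃ f : L → PointedOpen X, (∀ a, (f a).1.1 ⊆ Q.1.1) ∧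
      (∀ a b, a ≠ b → Disjoint (f a).1.1 (f b).1.1) ∧ (f a₀).1.2 = Q.1.2 ∧
      (∀ a, ∀ y ∈ (f a).1.1, ∀ z ∈ (f a).1.1, dist y z < 1 / ((n : ℝ) + 1)) ∧
      Q.1.1 ⊆ closure (⋃ a, (f a).1.1) := by
  obtain ⟨G, hGo, hGn, hGU, hGd, hx, hGs, hGc⟩ := hX.exists_partition Q.2.1 ⟨_, Q.2.2⟩ hlam hL a₀
    Q.2.2 (Nat.one_div_pos_of_nat (α := ℝ) (n := n))
  choose p hp using hGn
  classical
  refine ⟨fun a => ⟨(G a, if a = a₀ then Q.1.2 else p a), hGo a, ?_⟩, hGU, fun a b h => hGd h,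
    if_pos rfl, hGs, hGc⟩
  dsimp only
  split_ifs with h
  · exact h ▸ hx
  · exact hp a

theorem HasLocalDensity.exists_treeScheme [Nonempty X] {lam : Cardinal.{u}}
    (hX : HasLocalDensity X lam) (hlam : ℵ₀ ≤ lam) {L : Type u} (hL : #L = lam) :
    Nonempty (TreeScheme L X) := by
  have : Infinite L := infinite_iff.2 (hL ▸ hlam)
  let a₀ : L := Classical.arbitrary L
  choose f hsub hdisj hzero hsmall hdense using hX.exists_children hlam hL a₀
  let node : List L → PointedOpen X := fun s =>
    List.rec ⟨(univ, Classical.arbitrary X), isOpen_univ, mem_univ _⟩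
      (fun a s Q => f Q s.length a) s
  -- Children have dense union in their parent, so an open subset of a cell meets descendants of
  -- every depth.
  have hext : ∀ (n : ℕ) (s : List L) (V : Set X), IsOpen V → V.Nonempty → V ⊆ (node s).1.1 →
      ∃ t, s <:+ t ∧ n ≤ t.length ∧ ((node t).1.1 ∩ V).Nonempty := by
    intro n s V hV hne hVs
    induction n with
    | zero => exact ⟨s, List.suffix_rfl, Nat.zero_le _, by rwa [inter_eq_right.2 hVs]⟩
    | succ n ih =>
      obtain ⟨t, hst, hn, x, hxt, hxV⟩ := ih
      obtain ⟨y, hyV, hy⟩ := mem_closure_iff.1 (hdense (node t) t.length hxt) V hV hxV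
      obtain ⟨a, ha⟩ := mem_iUnion.1 hy
      exact ⟨a :: t, hst.trans (List.suffix_cons _ _), Nat.succ_le_succ hn, y, ha, hyV⟩
  refine ⟨{
    zero := a₀
    cell := fun s => (node s).1.1
    point := fun s => (node s).1.2
    isOpen_cell := fun s => (node s).2.1
    point_mem := fun s => (node s).2.2
    cell_cons_subset := fun a s => hsub _ _ a
    disjoint_cell := fun a b s h => hdisj _ _ a b h
    point_zero_cons := fun s => hzero _ _
    mem_root := mem_univ
    exists_cell_subset := fun s V hV hne hVs => ?_ }⟩
  obtain ⟨x, hx⟩ := hne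
  obtain ⟨r, hr, hball⟩ := Metric.isOpen_iff.1 hV x hx
  obtain ⟨n, hn⟩ := exists_nat_one_div_lt (half_pos hr)
  -- Depth `n + 1` rather than `n`: the root has no size bound, and a child is bounded through the
  -- length of its parent.
  obtain ⟨t, hst, hnt, y, hyt, hyV, hyx⟩ := hext (n + 1) s (V ∩ Metric.ball x (r / 2))
    (hV.inter Metric.isOpen_ball) ⟨x, hx, Metric.mem_ball_self (half_pos hr)⟩
    (inter_subset_left.trans hVs)
  refine ⟨t, hst, fun z hz => hball (Metric.mem_ball.2 ?_)⟩
  obtain _ | ⟨a, t⟩ := t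
  · simp at hnt
  · have h1 : dist z y < 1 / ((t.length : ℝ) + 1) := hsmall (node t) t.length a z hz y hyt
    have h2 : 1 / ((t.length : ℝ) + 1) ≤ 1 / ((n : ℝ) + 1) :=
      Nat.one_div_le_one_div (by simpa using hnt)
    have h3 := Metric.mem_ball.1 hyx
    linarith [dist_triangle z y x]

/-! ### Finite density -/

/-- A finite dense set is closed, so `X` is finite and discrete; an open singleton then forces
density one. -/
theorem HasLocalDensity.subsingleton_of_lt_aleph0 [Nonempty X] {lam : Cardinal.{u}}
    (hX : HasLocalDensity X lam) (hlam : lam < ℵ₀) : Subsingleton X ∧ lam = 1 := by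
  obtain ⟨D, -, hD, hDc⟩ := hX.exists_dense univ isOpen_univ univ_nonempty
  have hfin : D.Finite := lt_aleph0_iff_set_finite.1 (hDc ▸ hlam)
  rw [hfin.isClosed.closure_eq, univ_subset_iff] at hD
  subst hD
  have := finite_univ_iff.1 hfin
  obtain ⟨x⟩ := ‹Nonempty X›
  obtain ⟨E, hE, hEc, hEl⟩ := hX.exists_dense {x} (isOpen_discrete _) (singleton_nonempty x)
  obtain rfl | rfl := subset_singleton_iff_eq.1 hE
  · simp at hEc
  · rw [mk_singleton] at hEl
    refine ⟨?_, hEl.symm⟩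
    rw [← hEl, mk_univ] at hDc
    exact (eq_one_iff_unique.1 hDc).1

end Metric

theorem familyCof_nwd_le_of_subsingleton (X Y : Type u) [TopologicalSpace X] [TopologicalSpace Y]
    [Nonempty X] [Subsingleton X] : familyCof (nwd X) ≤ familyCof (nwd Y) := by
  refine familyCof_le_of_tukey (fun _ => ∅) (fun _ => ∅) (fun _ _ => isNowhereDense_empty)
    (fun _ _ => isNowhereDense_empty) fun A hA _ _ _ => ?_
  rcases Subsingleton.eq_empty_or_singleton subsingleton_of_subsingleton (s := A) with rfl | ⟨x, rfl⟩
  · exact Subset.rfl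
  · obtain ⟨V, -, -, ⟨y, hy⟩, hd⟩ :=
      IsNowhereDense.exists_isOpen_subset_disjoint hA isOpen_univ univ_nonempty
    exact absurd (Subsingleton.elim y x) (disjoint_left.1 hd hy)

/-- Here `ℕ → L` carries Mathlib's product topology; since `L` is a discrete space of cardinality
`lam`, it is the space `lam ^ ω`. An open set `U` is regarded as a subspace of `X`. -/
theorem theorem5p3 {X : Type u} [MetricSpace X] [Nonempty X] (lam : Cardinal.{u})
    (hX : ∀ U : Set X, IsOpen U → U.Nonempty → spaceDensity U = lam)
    (L : Type u) [TopologicalSpace L] [DiscreteTopology L] (hL : #L = lam) :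
    familyCof (nwd X) = familyCof (nwd (ℕ → L)) := by
  have hX' := hasLocalDensity_of_spaceDensity hX
  rcases lt_or_ge lam ℵ₀ with hlam | hlam
  · obtain ⟨hsub, rfl⟩ := hX'.subsingleton_of_lt_aleph0 hlam
    obtain ⟨hL1, hL2⟩ := eq_one_iff_unique.1 hL
    exact le_antisymm (familyCof_nwd_le_of_subsingleton _ _) (familyCof_nwd_le_of_subsingleton _ _)
  · have : Infinite L := infinite_iff.2 (hL ▸ hlam)
    obtain ⟨S⟩ := hX'.exists_treeScheme hlam hL
    obtain ⟨T⟩ := exists_treeScheme_pi L (Classical.arbitrary L)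
    exact S.familyCof_nwd_eq.trans T.familyCof_nwd_eq.symm
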